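/- Let $d\ge 1$ be an integer, let $p,q\in[1,\infty]$ satisfy $\frac2p+\frac dq=d$, and let $r\in(0,\infty]$ satisfy $r>\frac{2q}{q+1}$ (where $\frac{2q}{q+1}$ is read as $2$ if $q=\infty$). For $r<\infty$ let $\mathfrak S^r$ be the Schatten class of compact operators $\gamma$ on $L^2(\mathbb R^d;\mathbb C)$ with $\|\gamma\|_{\mathfrak S^r}=(\operatorname{Tr}|\gamma|^r)^{1/r}<\infty$, and let $\mathfrak S^\infty$ be the class of compact operators with the operator norm. The density $\rho_\gamma$ of an operator $\gamma$ is the locally integrable function (unique up to null sets) such that $\operatorname{Tr}(V\gamma)=\int_{\mathbb R^d}V(x)\rho_\gamma(x)\,dx$ for all bounded compactly supported $V$, where $V$ on the left is the multiplication operator; trace-class operators have a density. For a trace-class $\gamma$ (in particular $\gamma\in\mathfrak S^r$, as $r>1$) put $\gamma(t)=e^{it\Delta}\gamma e^{-it\Delta}$, where $e^{it\Delta}$ is the free Schrödinger group. Then $$\sup_{\gamma}\ \frac{\big\|\rho_{\gamma(t)}\big\|_{L^p_t(\mathbb R,\,L^q_x(\mathbb R^d))}}{\|\gamma\|_{\mathfrak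 S^r}}=+\infty ,$$ where the supremum is over all nonzero trace-class operators $\gamma$ on $L^2(\mathbb R^d;\mathbb C)$. In particular, the supremum over all nonzero $\gamma\in\mathfrak S^r$ for which the densities are defined is $+\infty$. -/

import Mathlib

open MeasureTheory
open scoped ENNReal InnerProductSpace FourierTransform

noncomputable section

/-! ### Traces and Schatten classes on a complex Hilbert space -/

section Schatten

variable {H : Type*} [NormedAddCommGroup H] [InnerProductSpace ℂ H] [CompleteSpace H]

variable (H) in
/-- The index set of a fixed orthonormal basis of `H`. -/
def onbIndex : Set H := (exists_hilbertBasis ℂ H).choose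

variable (H) in
/-- A fixed orthonormal (Hilbert) basis of `H`, used to compute traces. The traces of positive
operators and of trace-class operators do not depend on it. -/
def onb : HilbertBasis (onbIndex H) ℂ H := (exists_hilbertBasis ℂ H).choose_spec.choose

/-- The trace in `[0, ∞]` of a positive operator `A`, that is `∑ i, ⟪e i, A e i⟫`. -/
def positiveTrace (A : H →L[ℂ] H) : ℝ≥0∞ :=
  ∑' i, ENNReal.ofReal (⟪onb H i, A (onb H i)⟫_ℂ).re

/-- `HasTrace T z`: the series `∑ i, ⟪e i, T e i⟫` converges unconditionally, with sum `z`. -/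
def HasTrace (T : H →L[ℂ] H) (z : ℂ) : Prop :=
  HasSum (fun i => ⟪onb H i, T (onb H i)⟫_ℂ) z

/-- The Schatten norm `‖T‖_{𝔖^r} = (Tr |T|^r)^{1/r}` for `0 < r < ∞`, where `|T| = (T* T)^{1/2}`,
and the operator norm for `r = ∞`; it is `∞` if the trace is infinite. -/
def schattenENorm (T : H →L[ℂ] H) (r : ℝ≥0∞) : ℝ≥0∞ :=
  if r = ∞ then ‖T‖ₑ else positiveTrace (CFC.abs T ^ r.toReal) ^ (1 / r.toReal)

/-- The Schatten class `𝔖^r`: compact operators of finite Schatten norm (in particular, `𝔖^∞` is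
the class of all compact operators, and `𝔖^1` the trace class). -/
def MemSchatten (T : H →L[ℂ] H) (r : ℝ≥0∞) : Prop :=
  IsCompactOperator T ∧ schattenENorm T r < ∞

end Schatten

/-! ### The free Schrödinger evolution on `L²(ℝᵈ)` and densities of operators -/

/-- The Hilbert space `L²(ℝᵈ; ℂ)`. -/
abbrev L2 (d : ℕ) : Type := Lp ℂ 2 (volume : Measure (EuclideanSpace ℝ (Fin d)))

/-- The operator of multiplication by an essentially bounded function `V` on `L²(ℝᵈ)`. -/
def mulOp {d : ℕ} (V : EuclideanSpace ℝ (Fin d) → ℂ) (hV : MemLp V ∞ volume) :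
    L2 d →L[ℂ] L2 d :=
  (ContinuousLinearMap.mul ℂ ℂ).holderL volume ∞ 2 2 (hV.toLp V)

/-- The symbol of `e^{itΔ}`. With the normalization `𝓕 u ξ = ∫ e^{-2πi x·ξ} u(x) dx`, the operator
`Δ` corresponds to multiplication by `-4π²|ξ|²`. -/
def freeSymbol (d : ℕ) (t : ℝ) (ξ : EuclideanSpace ℝ (Fin d)) : ℂ :=
  Complex.exp (((-(4 * Real.pi ^ 2 * ‖ξ‖ ^ 2 * t) : ℝ) : ℂ) * Complex.I)

theorem memLp_freeSymbol (d : ℕ) (t : ℝ) : MemLp (freeSymbol d t) ∞ volume := by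
  refine memLp_top_of_bound (C := 1) ?_ (.of_forall fun ξ => ?_)
  · exact (show Continuous (freeSymbol d t) by unfold freeSymbol; fun_prop).aestronglyMeasurable
  · exact (Complex.norm_exp_ofReal_mul_I _).le

/-- The free Schrödinger group `e^{itΔ} = 𝓕⁻¹ e^{-4π²i|ξ|²t} 𝓕` on `L²(ℝᵈ)`. -/
def freeEvolution (d : ℕ) (t : ℝ) : L2 d →L[ℂ] L2 d :=
  let F := Lp.fourierTransformₗᵢ (EuclideanSpace ℝ (Fin d)) ℂ
  (F.symm : L2 d →L[ℂ] L2 d) ∘L mulOp (freeSymbol d t) (memLp_freeSymbol d t) ∘L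
    (F : L2 d →L[ℂ] L2 d)

/-- The evolved operator `γ(t) = e^{itΔ} γ e^{-itΔ}`. -/
def evolve {d : ℕ} (γ : L2 d →L[ℂ] L2 d) (t : ℝ) : L2 d →L[ℂ] L2 d :=
  freeEvolution d t ∘L γ ∘L freeEvolution d (-t)

/-- `ρ` is the density of the operator `γ`: `ρ` is locally integrable and `Tr (V γ) = ∫ V ρ` for
all bounded, compactly supported `V`. -/
structure IsDensity {d : ℕ} (γ : L2 d →L[ℂ] L2 d) (ρ : EuclideanSpace ℝ (Fin d) → ℂ) : Prop where
  locallyIntegrable : LocallyIntegrable ρ volume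
  hasTrace : ∀ (V : EuclideanSpace ℝ (Fin d) → ℂ) (hV : MemLp V ∞ volume), HasCompactSupport V →
    HasTrace (mulOp V hV ∘L γ) (∫ x, V x * ρ x)

/-- The density of an operator is unique up to null sets. -/
theorem IsDensity.ae_eq {d : ℕ} {γ : L2 d →L[ℂ] L2 d} {ρ σ : EuclideanSpace ℝ (Fin d) → ℂ}
    (hρ : IsDensity γ ρ) (hσ : IsDensity γ σ) : ρ =ᵐ[volume] σ := by
  have h : (fun x => ρ x - σ x) =ᵐ[volume] 0 := by
    refine ae_eq_zero_of_forall_setIntegral_isCompact_eq_zero'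
      (hρ.locallyIntegrable.sub hσ.locallyIntegrable) fun s hs => ?_
    have hV : MemLp (s.indicator (fun _ => (1 : ℂ))) ∞ volume :=
      memLp_indicator_const _ hs.measurableSet _ (.inr hs.measure_ne_top)
    have hc : HasCompactSupport (s.indicator (fun _ => (1 : ℂ))) :=
      HasCompactSupport.intro hs fun x hx => by simp [hx]
    have key : ∀ f : EuclideanSpace ℝ (Fin d) → ℂ,
        ∫ x, s.indicator (fun _ => (1 : ℂ)) x * f x = ∫ x in s, f x := fun f => by
      rw [← integral_indicator hs.measurableSet]
      congr 1 with x
      by_cases hx : x ∈ s <;> simp [hx]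
    have e := (hρ.hasTrace _ hV hc).unique (hσ.hasTrace _ hV hc)
    rw [key, key] at e
    have := integral_sub (hρ.locallyIntegrable.integrableOn_isCompact hs)
      (hσ.locallyIntegrable.integrableOn_isCompact hs)
    simpa [e] using this
  filter_upwards [h] with x hx using sub_eq_zero.mp hx

open Classical in
/-- The density `ρ_γ` of an operator `γ` that has one, such as a trace-class operator (and `0`
otherwise). -/
def density {d : ℕ} (γ : L2 d →L[ℂ] L2 d) : EuclideanSpace ℝ (Fin d) → ℂ :=
  if h : ∃ ρ, IsDensity γ ρ then h.choose else 0

/-- The mixed norm `‖ρ‖_{L^p_t(ℝ, L^q_x(ℝᵈ))}`, with values in `[0, ∞]`. -/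
def mixedENorm {d : ℕ} (p q : ℝ≥0∞) (ρ : ℝ → EuclideanSpace ℝ (Fin d) → ℂ) : ℝ≥0∞ :=
  eLpNorm (fun t => eLpNorm (ρ t) q volume) p volume

end

/-! ### Schatten norms and traces of finite-rank projections -/

section FiniteRank

open InnerProductSpace

variable {H : Type*} [NormedAddCommGroup H] [InnerProductSpace ℂ H]

/-! The obstruction is many orthogonal particles crossing the same place at once. Let `γ` project
onto `n ^ d` wave packets, all concentrated near the origin in space, with frequency profiles that
are translates of one bump to the lattice points of `{0, …, n-1}^d`. Disjoint frequency supports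
make them orthonormal, so `‖γ‖_{𝔖^r} ≤ n^{d/r}`. Speeds are `O(n)`, so for times up to about `1/n`
every packet has modulus at least a fixed `A` on a fixed ball (`exists_orthonormal_wavePackets`).
There the density is at least `A² n^d`, so its mixed norm is at least a constant times `n^{d-1/p}`
(`le_mixedENorm_of_forall_ae`). The quotient thus grows at least like `n^{d-1/p-d/r}`, and by the
scaling relation this exponent is positive exactly when `r > 2q/(q+1)`. -/

theorem isCompactOperator_rankOne (x y : H) : IsCompactOperator (rankOne ℂ x y) := by
  rw [rankOne_def']
  have h : IsCompactOperator (ContinuousLinearMap.toSpanSingleton ℂ x) :=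
    isCompactOperator_of_locallyCompactSpace_rng
      (ContinuousLinearMap.toSpanSingleton ℂ x)
  exact h.comp_clm _

theorem isCompactOperator_sum {ι : Type*} (s : Finset ι) {T : ι → H →L[ℂ] H}
    (hT : ∀ i ∈ s, IsCompactOperator (T i)) :
    IsCompactOperator (∑ i ∈ s, T i : H →L[ℂ] H) :=
  Submodule.sum_mem (compactOperator (RingHom.id ℂ) H H) (t := s) (f := fun i => (T i)) hT

theorem comp_sum_rankOne_comp {ι : Type*} [Fintype ι] {A B : H →L[ℂ] H}
    (hAB : ∀ f g, ⟪f, B g⟫_ℂ = ⟪A f, g⟫_ℂ) (u : ι → H) :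
    A ∘L (∑ k, rankOne ℂ (u k) (u k)) ∘L B = ∑ k, rankOne ℂ (A (u k)) (A (u k)) := by
  ext f
  simp [hAB]

variable [CompleteSpace H]

theorem Orthonormal.isStarProjection_sum_rankOne {ι : Type*} [Fintype ι] {u : ι → H}
    (hu : Orthonormal ℂ u) : IsStarProjection (∑ k, rankOne ℂ (u k) (u k)) where
  isIdempotentElem := by
    classical
    ext f
    simp only [mul_apply_eq_comp, sum_apply, rankOne_apply]
    refine Finset.sum_congr rfl fun k _ => ?_
    rw [inner_sum]
    simp [inner_smul_right, orthonormal_iff_ite.mp hu]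
  isSelfAdjoint := by
    rw [isSelfAdjoint_iff, star_sum]
    simp [ContinuousLinearMap.star_eq_adjoint]

/-- The spectrum lies in `{0, 1}`, where `x ^ r = x`. Hence Schatten norms of projections reduce to
traces. -/
theorem IsStarProjection.rpow_eq_self {T : H →L[ℂ] H} (hT : IsStarProjection T) {r : ℝ}
    (hr : 0 < r) : T ^ r = T := by
  have h0 : 0 ≤ T := hT.nonneg
  rw [CFC.rpow_def]
  conv_rhs => rw [← cfc_id' NNReal T]
  refine cfc_congr fun x hx => ?_
  have hx' : ((x : ℝ) : ℂ) ∈ spectrum ℂ T := by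
    have := spectrum.algebraMap_mem ℝ hx
    exact spectrum.algebraMap_mem ℂ this
  have := hT.isIdempotentElem.spectrum_subset ℂ hx'
  simp at this
  rcases this with h | h <;> simp [h, hr.ne']

/-- Parseval in the fixed basis: each unit vector contributes 1. -/
theorem Orthonormal.positiveTrace_sum_rankOne {ι : Type*} [Fintype ι] {u : ι → H}
    (hu : Orthonormal ℂ u) :
    positiveTrace (∑ k, rankOne ℂ (u k) (u k)) = Fintype.card ι := by
  have h1 : ∀ i, ENNReal.ofReal (⟪onb H i, (∑ k, rankOne ℂ (u k) (u k)) (onb H i)⟫_ℂ).re =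
      ∑ k, ENNReal.ofReal (‖⟪onb H i, u k⟫_ℂ‖ ^ 2) := fun i => by
    rw [← ENNReal.ofReal_sum_of_nonneg fun _ _ => by positivity]
    congr 1
    simp only [sum_apply, rankOne_apply, inner_sum, inner_smul_right,
      Complex.re_sum]
    refine Finset.sum_congr rfl fun k _ => ?_
    rw [← inner_conj_symm, mul_comm, Complex.mul_conj, Complex.ofReal_re, Complex.normSq_eq_norm_sq]
  have h2 : ∀ k, HasSum (fun i => ‖⟪onb H i, u k⟫_ℂ‖ ^ 2) 1 := fun k => by
    have := (onb H).hasSum_inner_mul_inner (u k) (u k)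
    rw [inner_self_eq_norm_sq_to_K, hu.1 k] at this
    have := Complex.hasSum_re this
    convert! this using 1
    · ext i
      rw [← inner_conj_symm (u k), mul_comm, Complex.mul_conj, Complex.ofReal_re,
        Complex.normSq_eq_norm_sq]
    · simp
  rw [positiveTrace]
  simp_rw [h1]
  rw [Summable.tsum_finsetSum fun _ _ => ENNReal.summable]
  have h3 : ∀ k, ∑' i, ENNReal.ofReal (‖⟪onb H i, u k⟫_ℂ‖ ^ 2) = 1 := fun k => by
    rw [← ENNReal.ofReal_tsum_of_nonneg (fun _ => by positivity) (h2 k).summable, (h2 k).tsum_eq,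
      ENNReal.ofReal_one]
  simp_rw [h3]
  simp

/-- For finite `r` this is an equality; for `r = ∞` the bound reads `‖T‖ ≤ 1`. -/
theorem Orthonormal.schattenENorm_sum_rankOne_le {ι : Type*} [Fintype ι] {u : ι → H}
    (hu : Orthonormal ℂ u) {r : ℝ≥0∞} (hr : r ≠ 0) :
    schattenENorm (∑ k, rankOne ℂ (u k) (u k)) r ≤ (Fintype.card ι : ℝ≥0∞) ^ (1 / r.toReal) := by
  have hP := hu.isStarProjection_sum_rankOne
  rw [schattenENorm]
  split_ifs with h
  · subst h
    have := hP.norm_le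
    simpa [enorm_le_iff_norm_le, ← ofReal_norm] using this
  · rw [CFC.abs_of_nonneg _ hP.nonneg, hP.rpow_eq_self (ENNReal.toReal_pos hr h),
      hu.positiveTrace_sum_rankOne]

theorem Orthonormal.memSchatten_sum_rankOne {ι : Type*} [Fintype ι] {u : ι → H}
    (hu : Orthonormal ℂ u) {r : ℝ≥0∞} (hr : r ≠ 0) :
    MemSchatten (∑ k, rankOne ℂ (u k) (u k)) r :=
  ⟨isCompactOperator_sum _ fun _ _ => isCompactOperator_rankOne _ _,
    (hu.schattenENorm_sum_rankOne_le hr).trans_lt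
      (ENNReal.rpow_lt_top_of_nonneg (by positivity) (ENNReal.natCast_ne_top _))⟩

theorem hasTrace_comp_sum_rankOne {ι : Type*} [Fintype ι] (T : H →L[ℂ] H) (u v : ι → H) :
    HasTrace (T ∘L ∑ k, rankOne ℂ (u k) (v k)) (∑ k, ⟪v k, T (u k)⟫_ℂ) := by
  have h := hasSum_sum fun k (_ : k ∈ Finset.univ) =>
    (onb H).hasSum_inner_mul_inner (v k) (T (u k))
  simpa [HasTrace, inner_sum, inner_smul_right] using h

end FiniteRank

/-! ### Densities of evolved finite-rank operators -/

section Density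

open InnerProductSpace

variable {d : ℕ}

theorem coeFn_mulOp {V : EuclideanSpace ℝ (Fin d) → ℂ} (hV : MemLp V ∞ volume) (f : L2 d) :
    mulOp V hV f =ᵐ[volume] fun x => V x * f x := by
  have h := (ContinuousLinearMap.mul ℂ ℂ).coeFn_holder (r := 2) (hV.toLp V) f
  refine (show mulOp V hV f =ᵐ[volume] _ from h).trans ?_
  filter_upwards [hV.coeFn_toLp] with x hx
  simp [hx]

theorem inner_mulOp_freeSymbol_neg (t : ℝ) (f g : L2 d) :
    ⟪f, mulOp (freeSymbol d (-t)) (memLp_freeSymbol d (-t)) g⟫_ℂ =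
      ⟪mulOp (freeSymbol d t) (memLp_freeSymbol d t) f, g⟫_ℂ := by
  rw [L2.inner_def, L2.inner_def]
  refine integral_congr_ae ?_
  filter_upwards [coeFn_mulOp (memLp_freeSymbol d (-t)) g, coeFn_mulOp (memLp_freeSymbol d t) f]
    with x hx hy
  rw [hx, hy]
  have : freeSymbol d (-t) x = (starRingEnd ℂ) (freeSymbol d t x) := by
    simp [freeSymbol, ← Complex.exp_conj, map_ofNat]
  simp [this]
  ring

theorem inner_freeEvolution_neg (t : ℝ) (f g : L2 d) :
    ⟪f, freeEvolution d (-t) g⟫_ℂ = ⟪freeEvolution d t f, g⟫_ℂ := by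
  set F := Lp.fourierTransformₗᵢ (EuclideanSpace ℝ (Fin d)) ℂ
  have h1 : freeEvolution d (-t) g =
    F.symm (mulOp (freeSymbol d (-t)) (memLp_freeSymbol d (-t)) (F g)) := rfl
  have h2 : freeEvolution d t f =
    F.symm (mulOp (freeSymbol d t) (memLp_freeSymbol d t) (F f)) := rfl
  rw [h1, h2, ← F.inner_map_map f, ← F.inner_map_map _ g, F.apply_symm_apply, F.apply_symm_apply,
    inner_mulOp_freeSymbol_neg]

theorem evolve_sum_rankOne {ι : Type*} [Fintype ι] (u : ι → L2 d) (t : ℝ) :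
    evolve (∑ k, rankOne ℂ (u k) (u k)) t =
      ∑ k, rankOne ℂ (freeEvolution d t (u k)) (freeEvolution d t (u k)) :=
  comp_sum_rankOne_comp (inner_freeEvolution_neg t) u

theorem isDensity_sum_rankOne {ι : Type*} [Fintype ι] (u : ι → L2 d) :
    IsDensity (∑ k, rankOne ℂ (u k) (u k)) (fun x => ∑ k, ((‖u k x‖ ^ 2 : ℝ) : ℂ)) where
  locallyIntegrable := by
    refine (integrable_finsetSum _ fun k _ => ?_).locallyIntegrable
    exact ((Lp.memLp (u k)).integrable_norm_pow (by norm_num)).ofReal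
  hasTrace V hV _ := by
    have h := hasTrace_comp_sum_rankOne (mulOp V hV) u u
    convert! h using 1
    have hint : ∀ k, Integrable (fun x => V x * ((‖u k x‖ ^ 2 : ℝ) : ℂ)) := fun k =>
      (((Lp.memLp (u k)).integrable_norm_pow (by norm_num)).ofReal).mul_of_top_right hV
    simp_rw [Finset.mul_sum]
    rw [integral_finsetSum _ fun k _ => hint k]
    refine Finset.sum_congr rfl fun k _ => ?_
    rw [L2.inner_def]
    refine integral_congr_ae ?_
    filter_upwards [coeFn_mulOp hV (u k)] with x hx
    rw [hx]
    simp only [RCLike.inner_apply]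
    rw [mul_assoc, Complex.mul_conj, Complex.normSq_eq_norm_sq]

/-- Evolution acts on each vector separately; `density` is a chosen representative, hence only a.e.
equality. -/
theorem density_evolve_sum_rankOne {ι : Type*} [Fintype ι] (u : ι → L2 d) (t : ℝ) :
    density (evolve (∑ k, rankOne ℂ (u k) (u k)) t) =ᵐ[volume]
      fun x => ∑ k, ((‖freeEvolution d t (u k) x‖ ^ 2 : ℝ) : ℂ) := by
  have h := isDensity_sum_rankOne fun k => freeEvolution d t (u k)
  rw [← evolve_sum_rankOne] at h
  have hex : ∃ ρ, IsDensity (evolve (∑ k, rankOne ℂ (u k) (u k)) t) ρ := ⟨_, h⟩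
  rw [density, dif_pos hex]
  exact hex.choose_spec.ae_eq h

end Density

/-! ### Lower bound for a single wave packet -/

section WavePacket

open SchwartzMap
open scoped ContDiff

variable {d : ℕ}

theorem freeEvolution_fourierInv_ae_eq (t : ℝ) (g : 𝓢(EuclideanSpace ℝ (Fin d), ℂ))
    (hg : HasCompactSupport g) :
    freeEvolution d t ((Lp.fourierTransformₗᵢ (EuclideanSpace ℝ (Fin d)) ℂ).symm
      (g.toLp 2 volume)) =ᵐ[volume] 𝓕⁻ (fun ξ => freeSymbol d t ξ * g ξ) := by
  set F := Lp.fourierTransformₗᵢ (EuclideanSpace ℝ (Fin d)) ℂ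
  have hc : HasCompactSupport fun ξ => freeSymbol d t ξ * g ξ := hg.mul_left
  have hs : ContDiff ℝ ∞ fun ξ => freeSymbol d t ξ * g ξ := by
    refine ContDiff.mul ?_ (g.smooth _)
    unfold freeSymbol
    have h1 : ContDiff ℝ ∞ fun ξ : EuclideanSpace ℝ (Fin d) =>
        -(4 * Real.pi ^ 2 * ‖ξ‖ ^ 2 * t) :=
      ((contDiff_const.mul (contDiff_norm_sq ℝ)).mul contDiff_const).neg
    exact ((Complex.ofRealCLM.contDiff.comp h1).mul contDiff_const).cexp
  have h1 : mulOp (freeSymbol d t) (memLp_freeSymbol d t) (g.toLp 2 volume) =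
      (hc.toSchwartzMap hs).toLp 2 volume := by
    refine Lp.ext ?_
    filter_upwards [coeFn_mulOp (memLp_freeSymbol d t) (g.toLp 2 volume),
      g.coeFn_toLp 2 volume, (hc.toSchwartzMap hs).coeFn_toLp 2 volume] with x h1 h2 h3
    rw [h1, h2, h3]
    rfl
  have h2 : freeEvolution d t (F.symm (g.toLp 2 volume)) =
      (𝓕⁻ (hc.toSchwartzMap hs)).toLp 2 volume := by
    rw [← SchwartzMap.toLp_fourierInv_eq, ← h1]
    change F.symm (mulOp _ _ (F (F.symm _))) = _
    rw [F.apply_symm_apply]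
    rfl
  rw [h2]
  filter_upwards [(𝓕⁻ (hc.toSchwartzMap hs)).coeFn_toLp 2 volume] with x hx
  rw [hx, SchwartzMap.fourierInv_coe]
  rfl

/-- After the constant phase `c` is factored out, the real part of the integrand is at least `(1 -
1/8) ψ`, so there is no cancellation. -/
theorem half_integral_le_norm_integral_cexp_mul {α : Type*} [MeasurableSpace α] {μ : Measure α}
    {ψ φ : α → ℝ} (hψ : Integrable ψ μ) (h0 : ∀ x, 0 ≤ ψ x) (hφ : AEStronglyMeasurable φ μ)
    (c : ℝ) (h : ∀ x, ψ x ≠ 0 → |φ x - c| ≤ 1 / 2) :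
    (∫ x, ψ x ∂μ) / 2 ≤ ‖∫ x, Complex.exp (φ x * Complex.I) * ψ x ∂μ‖ := by
  have hm : ∀ a : ℝ, Integrable (fun x => Complex.exp ((φ x - a : ℝ) * Complex.I) * ψ x) μ :=
    fun a => by
      refine hψ.ofReal.bdd_mul (c := 1) ?_ (.of_forall fun x =>
        (Complex.norm_exp_ofReal_mul_I _).le)
      exact (by fun_prop : Continuous fun y : ℝ =>
        Complex.exp ((y - a : ℝ) * Complex.I)).comp_aestronglyMeasurable hφ
  have h1 : ‖∫ x, Complex.exp (φ x * Complex.I) * ψ x ∂μ‖ =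
      ‖∫ x, Complex.exp ((φ x - c : ℝ) * Complex.I) * ψ x ∂μ‖ := by
    have : ∀ x, Complex.exp ((φ x - c : ℝ) * Complex.I) * ψ x =
        Complex.exp ((-c : ℝ) * Complex.I) * (Complex.exp (φ x * Complex.I) * ψ x) := fun x => by
      rw [← mul_assoc, ← Complex.exp_add]
      congr 2
      push_cast
      ring
    simp_rw [this]
    rw [integral_const_mul, norm_mul, Complex.norm_exp_ofReal_mul_I, one_mul]
  rw [h1, ← integral_div]
  refine le_trans ?_ (Complex.re_le_norm _)
  have h2 := integral_re (hm c)
  simp only [RCLike.re_to_complex] at h2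
  rw [← h2]
  refine integral_mono (hψ.div_const 2) (hm c).re fun x => ?_
  simp only [Complex.re_mul_ofReal, Complex.exp_ofReal_mul_I_re]
  by_cases hx : ψ x = 0
  · simp [hx]
  · have h3 := Real.one_sub_sq_div_two_le_cos (x := φ x - c)
    have h4 : (φ x - c) ^ 2 ≤ (1 / 2) ^ 2 := sq_le_sq' (abs_le.mp (h x hx)).1 (abs_le.mp (h x hx)).2
    nlinarith [h0 x]

theorem half_integral_le_norm_fourierInv {ψ : EuclideanSpace ℝ (Fin d) → ℝ} (hc : Continuous ψ)
    (hcs : HasCompactSupport ψ) (h0 : ∀ ξ, 0 ≤ ψ ξ) (hs : ∀ ξ, ψ ξ ≠ 0 → ‖ξ‖ ≤ 1 / 2)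
    {t : ℝ} {x k : EuclideanSpace ℝ (Fin d)} (hx : ‖x‖ ≤ 1 / 16)
    (htk : |t| * (‖k‖ + 1) ≤ 1 / 500) :
    (∫ ξ, ψ ξ) / 2 ≤ ‖𝓕⁻ (fun ξ => freeSymbol d t ξ * (ψ (ξ - k) : ℂ)) x‖ := by
  set φ : EuclideanSpace ℝ (Fin d) → ℝ := fun ξ =>
    2 * Real.pi * ⟪ξ + k, x⟫_ℝ - 4 * Real.pi ^ 2 * ‖ξ + k‖ ^ 2 * t with hφ
  have h1 : 𝓕⁻ (fun ξ => freeSymbol d t ξ * (ψ (ξ - k) : ℂ)) x =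
      ∫ ξ, Complex.exp (φ ξ * Complex.I) * ψ ξ := by
    rw [Real.fourierInv_eq', ← integral_add_right_eq_self _ k]
    congr 1 with ξ
    rw [add_sub_cancel_right, freeSymbol, smul_eq_mul, ← mul_assoc, ← Complex.exp_add, hφ]
    congr 2
    push_cast
    ring
  rw [h1]
  -- The reference phase is `φ 0`, the phase at the packet's central frequency `k`.
  refine half_integral_le_norm_integral_cexp_mul (hc.integrable_of_hasCompactSupport hcs) h0
    (by fun_prop) (2 * Real.pi * ⟪k, x⟫_ℝ - 4 * Real.pi ^ 2 * ‖k‖ ^ 2 * t) fun ξ hξ => ?_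
  have hξ := hs ξ hξ
  have h2 : φ ξ - (2 * Real.pi * ⟪k, x⟫_ℝ - 4 * Real.pi ^ 2 * ‖k‖ ^ 2 * t) =
      2 * Real.pi * ⟪ξ, x⟫_ℝ - 4 * Real.pi ^ 2 * (t * (‖ξ‖ ^ 2 + 2 * ⟪ξ, k⟫_ℝ)) := by
    simp only [hφ, inner_add_left, norm_add_sq_real]
    ring
  have h3 : |⟪ξ, x⟫_ℝ| ≤ 1 / 32 := (abs_real_inner_le_norm ξ x).trans <|
    (mul_le_mul hξ hx (norm_nonneg _) (by norm_num)).trans (by norm_num)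
  have h4 : |t * (‖ξ‖ ^ 2 + 2 * ⟪ξ, k⟫_ℝ)| ≤ 1 / 500 := by
    rw [abs_mul]
    refine le_trans (mul_le_mul_of_nonneg_left ?_ (abs_nonneg t)) htk
    have h5 : |⟪ξ, k⟫_ℝ| ≤ 1 / 2 * ‖k‖ := (abs_real_inner_le_norm ξ k).trans <|
      mul_le_mul_of_nonneg_right hξ (norm_nonneg _)
    have h6 : ‖ξ‖ ^ 2 ≤ (1 / 2) ^ 2 := pow_le_pow_left₀ (norm_nonneg _) hξ 2
    rw [abs_le] at h5 ⊢
    constructor <;> nlinarith [sq_nonneg ‖ξ‖]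
  rw [h2]
  have hpi := Real.pi_lt_d2
  have hpi0 := Real.pi_pos
  refine (abs_sub _ _).trans ?_
  rw [abs_mul, abs_mul (4 * Real.pi ^ 2), abs_of_pos (by positivity : 0 < 2 * Real.pi),
    abs_of_pos (by positivity : 0 < 4 * Real.pi ^ 2)]
  have h7 : Real.pi ^ 2 ≤ 10 := by nlinarith
  -- The phase deviation is at most `2π/32 + 4π²/500 < 1/2`.
  nlinarith [mul_le_mul_of_nonneg_left h3 hpi0.le, mul_le_mul_of_nonneg_left h4 (sq_nonneg Real.pi)]

/-- Radius `1/2` keeps translates to distinct lattice points disjoint. -/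
theorem exists_contDiff_normalized_bump (d : ℕ) :
    ∃ ψ : EuclideanSpace ℝ (Fin d) → ℝ, ContDiff ℝ ∞ ψ ∧ HasCompactSupport ψ ∧ (∀ ξ, 0 ≤ ψ ξ) ∧
      (∀ ξ, ψ ξ ≠ 0 → ‖ξ‖ < 1 / 2) ∧ ∫ ξ, ψ ξ ^ 2 = 1 ∧ 0 < ∫ ξ, ψ ξ := by
  let b : ContDiffBump (0 : EuclideanSpace ℝ (Fin d)) := ⟨1 / 4, 1 / 2, by norm_num, by norm_num⟩
  have hb2 : 0 < ∫ ξ, b ξ ^ 2 := by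
    refine Continuous.integral_pos_of_hasCompactSupport_nonneg_nonzero (x := 0)
      (by have := b.continuous; fun_prop) ?_ (fun ξ => sq_nonneg _) ?_
    · exact b.hasCompactSupport.comp_left (g := fun y : ℝ => y ^ 2) (by simp)
    · simp [b.one_of_mem_closedBall (Metric.mem_closedBall_self b.rIn_pos.le)]
  set c := (Real.sqrt (∫ ξ, b ξ ^ 2))⁻¹ with hc
  have hc0 : 0 < c := inv_pos.mpr (Real.sqrt_pos.mpr hb2)
  refine ⟨fun ξ => c * b ξ, contDiff_const.mul b.contDiff, b.hasCompactSupport.mul_left,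
    fun ξ => mul_nonneg hc0.le b.nonneg, fun ξ hξ => ?_, ?_, ?_⟩
  · have : ξ ∈ Function.support b := fun h => hξ (by simp [h])
    rw [b.support_eq] at this
    simpa [b] using this
  · simp_rw [mul_pow]
    rw [integral_const_mul, hc, inv_pow, Real.sq_sqrt hb2.le, inv_mul_cancel₀ hb2.ne']
  · rw [integral_const_mul]
    exact mul_pos hc0 b.integral_pos

end WavePacket

/-! ### The family of wave packets and the growth of the quotient -/

section WavePacketFamily

open SchwartzMap InnerProductSpace
open scoped ContDiff

theorem norm_toLp_natCast_le {d n : ℕ} (k : Fin d → Fin n) :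
    ‖(WithLp.toLp 2 fun i => ((k i : ℕ) : ℝ) : EuclideanSpace ℝ (Fin d))‖ ≤ d * n := by
  rw [EuclideanSpace.norm_eq]
  refine Real.sqrt_le_iff.mpr ⟨by positivity, ?_⟩
  calc ∑ i, ‖((k i : ℕ) : ℝ)‖ ^ 2 ≤ ∑ _i : Fin d, (n : ℝ) ^ 2 := by
        refine Finset.sum_le_sum fun i _ => ?_
        rw [Real.norm_natCast]
        exact pow_le_pow_left₀ (by positivity) (by exact_mod_cast (k i).2.le) 2
    _ = d * (n : ℝ) ^ 2 := by simp
    _ ≤ (d * n : ℝ) ^ 2 := by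
        rw [mul_pow]
        refine mul_le_mul_of_nonneg_right ?_ (by positivity)
        exact_mod_cast Nat.le_self_pow two_ne_zero d

theorem one_le_norm_toLp_natCast_sub {d n : ℕ} {k l : Fin d → Fin n} (h : k ≠ l) :
    1 ≤ ‖(WithLp.toLp 2 fun i => ((k i : ℕ) : ℝ) : EuclideanSpace ℝ (Fin d)) -
      WithLp.toLp 2 fun i => ((l i : ℕ) : ℝ)‖ := by
  obtain ⟨i, hi⟩ := Function.ne_iff.mp h
  refine le_trans ?_ (PiLp.norm_apply_le _ i)
  have h1 : ((k i : ℕ) : ℤ) - ((l i : ℕ) : ℤ) ≠ 0 := by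
    rw [sub_ne_zero]
    exact_mod_cast fun h2 => hi (Fin.ext h2)
  have h2 := Int.one_le_abs h1
  have h3 : (1 : ℝ) ≤ |((k i : ℕ) : ℝ) - ((l i : ℕ) : ℝ)| := by exact_mod_cast h2
  simpa using h3

/-- Wave packets localized near the origin in space, and near the points of a cubic lattice in
frequency, stay near the origin for a time inversely proportional to the largest frequency. -/
theorem exists_orthonormal_wavePackets (d : ℕ) :
    ∃ A : ℝ, 0 < A ∧ ∀ n : ℕ, ∃ u : (Fin d → Fin n) → L2 d, Orthonormal ℂ u ∧
      ∀ t : ℝ, |t| * (d * n + 1) ≤ 1 / 500 → ∀ k, ∀ᵐ x, ‖x‖ ≤ 1 / 16 →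
        A ≤ ‖freeEvolution d t (u k) x‖ := by
  obtain ⟨ψ, hψ, hcs, h0, hs, h2, h1⟩ := exists_contDiff_normalized_bump d
  refine ⟨(∫ ξ, ψ ξ) / 2, half_pos h1, fun n => ?_⟩
  set κ : (Fin d → Fin n) → EuclideanSpace ℝ (Fin d) := fun k =>
    WithLp.toLp 2 fun i => ((k i : ℕ) : ℝ) with hκ
  have hcs' : ∀ k, HasCompactSupport fun ξ => (ψ (ξ - κ k) : ℂ) := fun k =>
    (hcs.comp_homeomorph (Homeomorph.subRight (κ k))).comp_left (g := fun y : ℝ => (y : ℂ))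
      Complex.ofReal_zero
  have hsm : ∀ k, ContDiff ℝ ∞ fun ξ => (ψ (ξ - κ k) : ℂ) := fun k =>
    Complex.ofRealCLM.contDiff.comp (hψ.comp (contDiff_id.sub contDiff_const))
  set g : (Fin d → Fin n) → 𝓢(EuclideanSpace ℝ (Fin d), ℂ) := fun k =>
    (hcs' k).toSchwartzMap (hsm k) with hg
  set F := Lp.fourierTransformₗᵢ (EuclideanSpace ℝ (Fin d)) ℂ with hF
  refine ⟨fun k => F.symm ((g k).toLp 2 volume), ?_, fun t ht k => ?_⟩
  · classical
    rw [orthonormal_iff_ite]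
    intro k l
    rw [F.symm.inner_map_map, L2.inner_def]
    have e : ∫ ξ, ⟪(g k).toLp 2 volume ξ, (g l).toLp 2 volume ξ⟫_ℂ =
        ∫ ξ, ((ψ (ξ - κ k) * ψ (ξ - κ l) : ℝ) : ℂ) := by
      refine integral_congr_ae ?_
      filter_upwards [(g k).coeFn_toLp 2 volume, (g l).coeFn_toLp 2 volume] with ξ hk hl
      rw [hk, hl]
      simp [hg, mul_comm]
    rw [e]
    split_ifs with hkl
    · subst hkl
      rw [integral_complex_ofReal, integral_sub_right_eq_self (fun ξ => ψ ξ * ψ ξ)]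
      simp_rw [← pow_two, h2, Complex.ofReal_one]
    -- A common point of both supports would put two lattice points at distance less than 1.
    · refine integral_eq_zero_of_ae (.of_forall fun ξ => ?_)
      by_contra hne
      have hne : ψ (ξ - κ k) ≠ 0 ∧ ψ (ξ - κ l) ≠ 0 := by simpa using hne
      have h3 := hs _ hne.1
      have h4 := hs _ hne.2
      have h5 := one_le_norm_toLp_natCast_sub hkl
      have h6 := norm_sub_le (ξ - κ l) (ξ - κ k)
      rw [sub_sub_sub_cancel_left] at h6
      linarith
  · filter_upwards [freeEvolution_fourierInv_ae_eq t (g k) (hcs' k)] with x hx hx16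
    rw [hx]
    refine half_integral_le_norm_fourierInv hψ.continuous hcs h0 (fun ξ hξ => (hs ξ hξ).le) hx16
      (le_trans (mul_le_mul_of_nonneg_left ?_ (abs_nonneg t)) ht)
    have := norm_toLp_natCast_le k
    linarith

/-- Comparison with indicators of the ball and of `[0, τ]`. For an infinite exponent `1 / toReal` is
`0`, so the measure factor is correctly 1. -/
theorem le_mixedENorm_of_forall_ae {d : ℕ} {p q : ℝ≥0∞} (hp : p ≠ 0) (hq : q ≠ 0)
    {ρ : ℝ → EuclideanSpace ℝ (Fin d) → ℂ} {B τ R : ℝ} (hR : 0 < R) (hτ : 0 < τ)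
    (h : ∀ t ∈ Set.Icc 0 τ, ∀ᵐ x, ‖x‖ ≤ R → B ≤ ‖ρ t x‖) :
    ENNReal.ofReal B * volume (Metric.closedBall (0 : EuclideanSpace ℝ (Fin d)) R) ^ (1 / q.toReal) *
      ENNReal.ofReal τ ^ (1 / p.toReal) ≤ mixedENorm p q ρ := by
  have hball := (Metric.measure_closedBall_pos volume (0 : EuclideanSpace ℝ (Fin d)) hR).ne'
  have h1 : ∀ t ∈ Set.Icc 0 τ, ENNReal.ofReal B *
      volume (Metric.closedBall (0 : EuclideanSpace ℝ (Fin d)) R) ^ (1 / q.toReal) ≤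
        eLpNorm (ρ t) q volume := fun t ht => by
    have := eLpNorm_indicator_const' (c := ENNReal.ofReal B) (p := q)
      (Metric.isClosed_closedBall (x := (0 : EuclideanSpace ℝ (Fin d))) (ε := R)).measurableSet
      hball hq
    rw [enorm_eq_self] at this
    rw [← this]
    refine eLpNorm_mono_enorm_ae ?_
    filter_upwards [h t ht] with x hx
    by_cases hxR : x ∈ Metric.closedBall (0 : EuclideanSpace ℝ (Fin d)) R
    · rw [Set.indicator_of_mem hxR, enorm_eq_self, ← ofReal_norm]
      exact ENNReal.ofReal_le_ofReal (hx (by simpa using hxR))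
    · simp [hxR]
  set M := ENNReal.ofReal B *
    volume (Metric.closedBall (0 : EuclideanSpace ℝ (Fin d)) R) ^ (1 / q.toReal)
  have h2 := eLpNorm_indicator_const' (c := M) (p := p) (μ := (volume : Measure ℝ))
    (measurableSet_Icc (a := (0 : ℝ)) (b := τ)) (by simp [hτ]) hp
  rw [enorm_eq_self, Real.volume_Icc, sub_zero] at h2
  rw [← h2, mixedENorm]
  refine eLpNorm_mono_enorm fun t => ?_
  by_cases ht : t ∈ Set.Icc 0 τ
  · rw [Set.indicator_of_mem ht, enorm_eq_self, enorm_eq_self]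
    exact h1 t ht
  · simp [ht]

theorem exists_le_mixedENorm_div_schattenENorm {d : ℕ} (hd : 1 ≤ d) {p q r : ℝ≥0∞} (hp : p ≠ 0)
    (hq : q ≠ 0) (hr : r ≠ 0) :
    ∃ C : ℝ, 0 < C ∧ ∀ n : ℕ, 1 ≤ n → ∃ γ : L2 d →L[ℂ] L2 d,
      MemSchatten γ r ∧ MemSchatten γ 1 ∧ γ ≠ 0 ∧
      ENNReal.ofReal (C * (n : ℝ) ^ (d - 1 / p.toReal - d * (1 / r.toReal))) ≤
        mixedENorm p q (fun t => density (evolve γ t)) / schattenENorm γ r := by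
  obtain ⟨A, hA, hu⟩ := exists_orthonormal_wavePackets d
  have hd0 : (0 : ℝ) < d := by exact_mod_cast hd
  set v := (volume (Metric.closedBall (0 : EuclideanSpace ℝ (Fin d)) (1 / 16))).toReal with hv
  have hvtop : volume (Metric.closedBall (0 : EuclideanSpace ℝ (Fin d)) (1 / 16)) ≠ ⊤ :=
    measure_closedBall_lt_top.ne
  have hv0 : 0 < v := ENNReal.toReal_pos
    (Metric.measure_closedBall_pos volume _ (by norm_num)).ne' hvtop
  refine ⟨A ^ 2 * v ^ (1 / q.toReal) * (1 / (1000 * d)) ^ (1 / p.toReal), by positivity,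
    fun n hn => ?_⟩
  have hn0 : (0 : ℝ) < n := by exact_mod_cast hn
  obtain ⟨u, ho, hu⟩ := hu n
  have hne : (∑ k, rankOne ℂ (u k) (u k)) ≠ 0 := fun h => by
    have h1 := ho.positiveTrace_sum_rankOne
    rw [h] at h1
    have h2 : n ≠ 0 := by omega
    simp [positiveTrace, h2, eq_comm] at h1
  refine ⟨∑ k, rankOne ℂ (u k) (u k), ho.memSchatten_sum_rankOne hr,
    ho.memSchatten_sum_rankOne one_ne_zero, hne, ?_⟩
  have hS := ho.schattenENorm_sum_rankOne_le hr
  -- Since `d * n + 1 ≤ 2 * d * n`, this `τ` meets the time bound `1 / 500`.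
  have hM := le_mixedENorm_of_forall_ae (d := d) hp hq (R := 1 / 16) (τ := 1 / (1000 * d * n))
    (B := n ^ d * A ^ 2) (ρ := fun t => density (evolve (∑ k, rankOne ℂ (u k) (u k)) t))
    (by norm_num) (by positivity) fun t ht => by
      have htt : |t| * (d * n + 1) ≤ 1 / 500 := by
        rw [abs_of_nonneg ht.1]
        have h1 : (1 : ℝ) ≤ d * n := by exact_mod_cast Nat.mul_pos hd hn
        have h2 := (le_div_iff₀ (by positivity)).mp ht.2
        nlinarith [ht.1]
      filter_upwards [density_evolve_sum_rankOne u t, ae_all_iff.mpr (hu t htt)] with x hx hxu hx16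
      rw [hx, ← Complex.ofReal_sum, Complex.norm_real, Real.norm_eq_abs]
      refine le_trans ?_ (le_abs_self _)
      calc (n : ℝ) ^ d * A ^ 2 = ∑ _k : Fin d → Fin n, A ^ 2 := by simp
        _ ≤ _ := Finset.sum_le_sum fun k _ => pow_le_pow_left₀ hA.le (hxu k hx16) 2
  have hcard : (Fintype.card (Fin d → Fin n) : ℝ≥0∞) ^ (1 / r.toReal) =
      ENNReal.ofReal ((n : ℝ) ^ (d * (1 / r.toReal))) := by
    rw [Real.rpow_mul hn0.le, ← ENNReal.ofReal_rpow_of_pos (by positivity), Real.rpow_natCast]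
    congr 1
    simp [ENNReal.ofReal_pow hn0.le]
  rw [hcard] at hS
  refine le_trans ?_ (ENNReal.div_le_div hM hS)
  rw [← ENNReal.ofReal_toReal hvtop, ENNReal.ofReal_rpow_of_pos hv0,
    ENNReal.ofReal_rpow_of_pos (by positivity), ← ENNReal.ofReal_mul (by positivity),
    ← ENNReal.ofReal_mul (by positivity), ← ENNReal.ofReal_div_of_pos (by positivity)]
  refine ENNReal.ofReal_le_ofReal (le_of_eq ?_)
  rw [Real.rpow_sub hn0, Real.rpow_sub hn0, Real.rpow_natCast,
    ← div_div 1 (1000 * (d : ℝ)) (n : ℝ), Real.div_rpow (by positivity) hn0.le]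
  ring

/-- Substituting `1/p = (d/2)(1 - 1/q)` turns the exponent into `d ((1 + 1/q)/2 - 1/r)`. -/
theorem exponent_pos {d : ℕ} (hd : 1 ≤ d) {p q r : ℝ≥0∞} (hp : 1 ≤ p) (hq : 1 ≤ q)
    (hpq : 2 / p + d / q = d) (hr : 2 / (1 + 1 / q) < r) :
    0 < d - 1 / p.toReal - d * (1 / r.toReal) := by
  have hp' : p⁻¹ ≠ ⊤ := by simpa using (one_pos.trans_le hp).ne'
  have hq' : q⁻¹ ≠ ⊤ := by simpa using (one_pos.trans_le hq).ne'
  have hd0 : (0 : ℝ) < d := by exact_mod_cast hd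
  have h1 : 2 * (1 / p.toReal) + d * (1 / q.toReal) = d := by
    have := congrArg ENNReal.toReal hpq
    rw [div_eq_mul_inv, div_eq_mul_inv, ENNReal.toReal_add (by finiteness) (by finiteness)] at this
    simpa using this
  have h2 : 1 / r.toReal < (1 + 1 / q.toReal) / 2 := by
    have h3 := ENNReal.inv_lt_inv.mpr hr
    rw [ENNReal.inv_div (by simp) (by simp)] at h3
    have hfin : (1 + 1 / q) / 2 ≠ ⊤ := by
      rw [one_div]
      finiteness
    have := (ENNReal.toReal_lt_toReal (h3.trans_le le_top).ne hfin).mpr h3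
    rw [one_div q, ENNReal.toReal_div, ENNReal.toReal_add (by simp) hq'] at this
    simpa using this
  nlinarith

end WavePacketFamily

/-- The supremum is taken over trace-class `γ` only (all of which are in `𝔖^r`, and have a density
at every time); this is stronger than taking it over all `γ ∈ 𝔖^r` that have densities. The number
`2 / (1 + 1 / q)` is `2q / (q + 1)`, read as `2` for `q = ∞`. -/
theorem mainTheorem5 (d : ℕ) (hd : 1 ≤ d) (p q r : ℝ≥0∞) (hp : 1 ≤ p) (hq : 1 ≤ q)
    (hpq : 2 / p + d / q = d) (hr : 2 / (1 + 1 / q) < r) :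
    (⨆ γ ∈ {γ : L2 d →L[ℂ] L2 d | MemSchatten γ r ∧ MemSchatten γ 1 ∧ γ ≠ 0},
      mixedENorm p q (fun t => density (evolve γ t)) / schattenENorm γ r) = (∞ : ℝ≥0∞) := by
  obtain ⟨C, hC, h⟩ := exists_le_mixedENorm_div_schattenENorm hd (p := p) (q := q) (r := r)
    (one_pos.trans_le hp).ne' (one_pos.trans_le hq).ne' (bot_le.trans_lt hr).ne'
  have hδ := exponent_pos hd hp hq hpq hr
  have hlim := ENNReal.tendsto_ofReal_atTop.comp <|
    ((tendsto_rpow_atTop hδ).comp tendsto_natCast_atTop_atTop).const_mul_atTop hC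
  refine top_le_iff.mp (le_of_tendsto hlim ?_)
  filter_upwards [Filter.eventually_ge_atTop 1] with n hn
  obtain ⟨γ, h1, h2, h3, h4⟩ := h n hn
  exact h4.trans (le_iSup₂_of_le γ ⟨h1, h2, h3⟩ le_rfl)
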